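/- Let $F$ be a connected (Hausdorff) complex manifold of dimension $n\ge 0$, and let $G$ be any subgroup of the group $\mathrm{Diff}(F)$ of holomorphic diffeomorphisms of $F$ (biholomorphic maps $F\to F$, under composition); $G$ is not assumed to be finitely generated. Let $\Omega(G)\subset F$ be the set of points $x\in F$ whose orbit $\{g(x) : g\in G\}$ is finite. Then $G$ is a finite group, or $\Omega(G)$ has zero measure in $F$. Here a subset $X\subset F$ is said to have zero measure in $F$ if $F$ admits an open cover by holomorphic coordinate charts $\varphi\colon U\to\varphi(U)\subset\mathbb C^n=\mathbb R^{2n}$ such that each $\varphi(U\cap X)$ has zero Lebesgue measure. -/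

import Mathlib

open scoped Manifold ContDiff
open MeasureTheory

/-- The holomorphic diffeomorphisms of a complex manifold `F` of dimension `n`, i.e. the bijections
of `F` that are complex analytic together with their inverse. -/
abbrev HolDiff (n : ℕ) (F : Type*) [TopologicalSpace F] [ChartedSpace (Fin n → ℂ) F] : Type _ :=
  Diffeomorph 𝓘(ℂ, Fin n → ℂ) 𝓘(ℂ, Fin n → ℂ) F F ω

namespace HolDiff

variable {n : ℕ} {F : Type*} [TopologicalSpace F] [ChartedSpace (Fin n → ℂ) F]

/-- Holomorphic diffeomorphisms form a group under composition: `(f * g) x = f (g x)`. -/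
noncomputable instance instGroup : Group (HolDiff n F) where
  mul f g := Diffeomorph.trans g f
  one := Diffeomorph.refl _ F ω
  inv f := Diffeomorph.symm f
  mul_assoc _ _ _ := rfl
  one_mul _ := rfl
  mul_one _ := rfl
  inv_mul_cancel f := Diffeomorph.self_trans_symm f

/-- The tautological action of the holomorphic diffeomorphisms on `F`: `f • x = f x`. -/
noncomputable instance instMulAction : MulAction (HolDiff n F) F where
  smul f x := f x
  one_smul _ := rfl
  mul_smul _ _ _ := rfl

theorem smul_def (f : HolDiff n F) (x : F) : f • x = f x := rfl

theorem mul_apply (f g : HolDiff n F) (x : F) : (f * g) x = f (g x) := rfl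

/-- `Ω(G)`: the set of points of `F` whose `G`-orbit is finite. -/
def finiteOrbitSet (G : Subgroup (HolDiff n F)) : Set F :=
  {x | (MulAction.orbit G x).Finite}

end HolDiff

/-- A subset `X` of a complex manifold `F` of dimension `n` has zero measure if `F` is covered by
the domains of holomorphic coordinate charts `φ : U → φ(U) ⊆ ℂⁿ = ℝ²ⁿ` such that `φ(U ∩ X)` is
Lebesgue-null. -/
def HasZeroMeasure (n : ℕ) {F : Type*} [TopologicalSpace F] [ChartedSpace (Fin n → ℂ) F]
    (X : Set F) : Prop :=
  ∃ A : Set (OpenPartialHomeomorph F (Fin n → ℂ)),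
    A ⊆ IsManifold.maximalAtlas 𝓘(ℂ, Fin n → ℂ) ω F ∧
    (⋃ φ ∈ A, φ.source) = Set.univ ∧
    ∀ φ ∈ A, volume (φ '' (φ.source ∩ X)) = 0

open Filter Topology

/-! If $G$ is infinite, choose distinct $u_0, u_1, \dots$ in it. By pigeonhole, a point with finite
orbit satisfies $u_i x = u_j x$ for some $i \ne j$, so countably many sets
$\mathrm{Fix}(u_i^{-1}u_j)$ cover $\Omega(G)$, even for uncountable $G$. In a chart,
$\mathrm{Fix}(g)$ is locally the zero set of the analytic map $\varphi g\varphi^{-1} - \mathrm{id}$.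
This set is null unless the map vanishes on an open set, and then $g = 1$ by the identity theorem.
-/

/-- A measurable set that meets every line through a given point in a null set is null. -/
theorem MeasureTheory.Measure.addHaar_eq_zero_of_forall_ae_notMem_line {E : Type*}
    [NormedAddCommGroup E] [NormedSpace ℝ E] [FiniteDimensional ℝ E] [MeasurableSpace E]
    [BorelSpace E] (μ : Measure E) [μ.IsAddHaarMeasure] {s : Set E} (hs : MeasurableSet s) (a : E)
    (h : ∀ v : E, ∀ᵐ t : ℝ, a + t • v ∉ s) : μ s = 0 := by
  have hm : MeasurableSet {q : E × ℝ | a + q.2 • q.1 ∉ s} :=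
    (hs.preimage (by fun_prop : Continuous fun q : E × ℝ ↦ a + q.2 • q.1).measurable).compl
  -- Fubini. One good `t ≠ 0` then suffices, since `v ↦ a + t • v` scales `μ` by a nonzero constant.
  have hae : ∀ᵐ t : ℝ, ∀ᵐ v ∂μ, a + t • v ∉ s :=
    (Measure.ae_ae_comm hm).1 (ae_of_all _ h)
  have hne : ∀ᵐ t : ℝ, t ≠ 0 := by simp [ae_iff]
  obtain ⟨t, ht, ht0⟩ := (hae.and hne).exists
  have hpre : μ ((t • ·) ⁻¹' ((a + ·) ⁻¹' s)) = 0 := by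
    simp only [ae_iff, not_not] at ht
    exact ht
  rw [Measure.addHaar_preimage_smul μ ht0, measure_preimage_add] at hpre
  refine (mul_eq_zero.1 hpre).resolve_left ?_
  simp [ht0]

/-- An analytic function on a finite-dimensional space either vanishes near a given point,
or its zero set is null near that point. -/
theorem AnalyticAt.eventually_eq_zero_or_exists_measure_zero {E F : Type*}
    [NormedAddCommGroup E] [NormedSpace ℝ E] [FiniteDimensional ℝ E] [MeasurableSpace E]
    [BorelSpace E] (μ : Measure E) [μ.IsAddHaarMeasure] [NormedAddCommGroup F] [NormedSpace ℝ F]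
    [CompleteSpace F] {f : E → F} {p : E} (hf : AnalyticAt ℝ f p) :
    (∀ᶠ z in 𝓝 p, f z = 0) ∨ ∃ U ∈ 𝓝 p, μ (U ∩ {z | f z = 0}) = 0 := by
  obtain ⟨r, hr, hfr⟩ := Metric.eventually_nhds_iff_ball.1 hf.eventually_analyticAt
  set B := Metric.ball p r
  refine or_iff_not_imp_left.2 fun hne ↦ ⟨B, Metric.ball_mem_nhds p hr, ?_⟩
  obtain ⟨a, haB, ha⟩ : ∃ a ∈ B, f a ≠ 0 := by
    by_contra! hall
    exact hne (eventually_of_mem (Metric.ball_mem_nhds p hr) hall)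
  have hfB : AnalyticOnNhd ℝ f B := hfr
  have hopen : IsOpen (B ∩ f ⁻¹' {0}ᶜ) :=
    hfB.continuousOn.isOpen_inter_preimage Metric.isOpen_ball isOpen_compl_singleton
  have hmeas : MeasurableSet (B ∩ {z | f z = 0}) := by
    have : B ∩ {z | f z = 0} = B \ (B ∩ f ⁻¹' {0}ᶜ) := by
      ext z
      simp
    rw [this]
    exact measurableSet_ball.diff hopen.measurableSet
  -- As `f a ≠ 0`, `f` is not identically zero on the part in `B` of any line through `a`; its zeros
  -- there are isolated, hence null.
  refine μ.addHaar_eq_zero_of_forall_ae_notMem_line hmeas a fun v ↦ ?_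
  set T : Set ℝ := {t | a + t • v ∈ B}
  have hTopen : IsOpen T := Metric.isOpen_ball.preimage (by fun_prop)
  have hTconv : Convex ℝ T := by
    have := (convex_ball p r).affine_preimage (AffineMap.lineMap a (a + v) : ℝ →ᵃ[ℝ] E)
    have hT : T = AffineMap.lineMap (k := ℝ) a (a + v) ⁻¹' B := by
      ext t
      simp [T, AffineMap.lineMap_apply, add_comm]
    rwa [hT]
  have hg : AnalyticOnNhd ℝ (fun t : ℝ ↦ f (a + t • v)) T := fun t ht ↦
    (hfB _ ht).comp (f := fun t : ℝ ↦ a + t • v) (by fun_prop)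
  rcases hg.eqOn_zero_or_eventually_ne_zero_of_preconnected hTconv.isPreconnected with h0 | h1
  · exact absurd (by simpa using h0 (show (0 : ℝ) ∈ T by simpa [T] using haB)) ha
  · have := (ae_restrict_iff' (μ := volume) hTopen.measurableSet).1
      (ae_restrict_le_codiscreteWithin hTopen.measurableSet h1)
    filter_upwards [this] with t ht ht'
    exact ht ht'.1 ht'.2

namespace HolDiff

variable {n : ℕ} {F : Type*} [TopologicalSpace F] [ChartedSpace (Fin n → ℂ) F]

/-- The local expression of a holomorphic diffeomorphism in a chart is analytic. -/
theorem analyticAt_chart [IsManifold 𝓘(ℂ, Fin n → ℂ) ω F] (g : HolDiff n F)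
    {φ : OpenPartialHomeomorph F (Fin n → ℂ)}
    (hφ : φ ∈ IsManifold.maximalAtlas 𝓘(ℂ, Fin n → ℂ) ω F) {z : Fin n → ℂ}
    (hz : z ∈ φ.target) (hgz : g (φ.symm z) ∈ φ.source) :
    AnalyticAt ℂ (fun w ↦ φ (g (φ.symm w))) z := by
  have h1 := contMDiffAt_of_mem_maximalAtlas hφ hgz
  have h2 := contMDiffAt_symm_of_mem_maximalAtlas hφ hz
  exact (contMDiffAt_iff_contDiffAt.1 (h1.comp z ((g.contMDiff _).comp z h2))).analyticAt

/-- Near a fixed point, being fixed by `g` is vanishing of an analytic function in a chart. -/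
theorem eventually_apply_eq_iff (g : HolDiff n F) (φ : OpenPartialHomeomorph F (Fin n → ℂ))
    {z : Fin n → ℂ} (hz : z ∈ φ.target) (hgz : g (φ.symm z) ∈ φ.source) :
    ∀ᶠ w in 𝓝 z, (g (φ.symm w) = φ.symm w ↔ φ (g (φ.symm w)) - w = 0) := by
  have hcont : ContinuousAt (fun w ↦ g (φ.symm w)) z :=
    g.continuous.continuousAt.comp (φ.continuousAt_symm hz)
  filter_upwards [φ.open_target.mem_nhds hz, hcont (φ.open_source.mem_nhds hgz)] with w hw hgw
  rw [sub_eq_zero, φ.eq_symm_apply hgw hw]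

/-- Identity theorem: a holomorphic diffeomorphism of a connected manifold which is the identity
near some point is the identity. -/
theorem eq_one_of_eventually [IsManifold 𝓘(ℂ, Fin n → ℂ) ω F] [T2Space F] [ConnectedSpace F]
    (g : HolDiff n F) {x : F} (hx : ∀ᶠ y in 𝓝 x, g y = y) : g = 1 := by
  set W : Set F := {x | ∀ᶠ y in 𝓝 x, g y = y}
  have hWopen : IsOpen W := isOpen_setOfPred_eventually_nhds
  have hWclosed : IsClosed W := by
    refine isClosed_of_closure_subset fun y hy ↦ ?_
    -- Fixing `y` lets one chart at `y` serve as both source and target for `g` near `y`.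
    have hfix : g y = y := by
      have hcl : IsClosed {y | g y = y} := isClosed_eq g.continuous continuous_id
      exact closure_minimal (fun w hw ↦ Eventually.self_of_nhds hw) hcl hy
    set φ := chartAt (Fin n → ℂ) y
    have hφ : φ ∈ IsManifold.maximalAtlas 𝓘(ℂ, Fin n → ℂ) ω F :=
      IsManifold.chart_mem_maximalAtlas y
    have hys : y ∈ φ.source := mem_chart_source _ y
    have hyt : φ y ∈ φ.target := φ.map_source hys
    have hgy : g (φ.symm (φ y)) ∈ φ.source := by rwa [φ.left_inv hys, hfix]
    obtain ⟨r, hr, hball⟩ := Metric.eventually_nhds_iff_ball.1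
      (((analyticAt_chart g hφ hyt hgy).eventually_analyticAt.and
        (g.eventually_apply_eq_iff φ hyt hgy)).and (φ.open_target.mem_nhds hyt))
    have hnhds : φ.source ∩ φ ⁻¹' Metric.ball (φ y) r ∈ 𝓝 y :=
      inter_mem (φ.open_source.mem_nhds hys)
        (φ.continuousAt hys (Metric.ball_mem_nhds _ hr))
    obtain ⟨w, ⟨hws, hwb⟩, hwW⟩ := mem_closure_iff_nhds.1 hy _ hnhds
    have han : AnalyticOnNhd ℂ (fun w ↦ φ (g (φ.symm w)) - w) (Metric.ball (φ y) r) :=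
      fun v hv ↦ (hball v hv).1.1.sub analyticAt_id
    have hw0 : (fun w ↦ φ (g (φ.symm w)) - w) =ᶠ[𝓝 (φ w)] 0 := by
      have htend : Tendsto φ.symm (𝓝 (φ w)) (𝓝 w) := φ.tendsto_symm hws
      filter_upwards [htend.eventually hwW, Metric.isOpen_ball.mem_nhds hwb] with v hv hvb
      exact (hball v hvb).1.2.1 hv
    have hzero := han.eqOn_zero_of_preconnected_of_eventuallyEq_zero
      (convex_ball (φ y) r).isPreconnected hwb hw0
    filter_upwards [hnhds] with v hv
    simpa [φ.left_inv hv.1] using (hball _ hv.2).1.2.2 (hzero hv.2)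
  have hWuniv : W = Set.univ := IsClopen.eq_univ ⟨hWclosed, hWopen⟩ ⟨x, hx⟩
  refine Diffeomorph.ext fun y ↦ ?_
  have hy : y ∈ W := hWuniv ▸ Set.mem_univ y
  exact Eventually.self_of_nhds (p := fun z ↦ g z = z) hy

/-- The fixed point set of a nontrivial holomorphic diffeomorphism is null in every chart. -/
theorem measure_image_fixedBy_eq_zero [IsManifold 𝓘(ℂ, Fin n → ℂ) ω F] [T2Space F]
    [ConnectedSpace F] {g : HolDiff n F} (hg : g ≠ 1) {φ : OpenPartialHomeomorph F (Fin n → ℂ)}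
    (hφ : φ ∈ IsManifold.maximalAtlas 𝓘(ℂ, Fin n → ℂ) ω F) :
    volume (φ '' (φ.source ∩ MulAction.fixedBy F g)) = 0 := by
  -- Working in $\mathbb C^n$, which is second countable, avoids any countability assumption on `F`.
  refine measure_null_of_locally_null _ ?_
  rintro _ ⟨x, ⟨hxs, hgx⟩, rfl⟩
  have hgx : g x = x := hgx
  have hxt : φ x ∈ φ.target := φ.map_source hxs
  have hgs : g (φ.symm (φ x)) ∈ φ.source := by rwa [φ.left_inv hxs, hgx]
  have hiff := g.eventually_apply_eq_iff φ hxt hgs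
  have han : AnalyticAt ℝ (fun w ↦ φ (g (φ.symm w)) - w) (φ x) :=
    ((analyticAt_chart g hφ hxt hgs).sub analyticAt_id).restrictScalars
  rcases han.eventually_eq_zero_or_exists_measure_zero volume with h0 | ⟨U, hU, hU0⟩
  · refine absurd (g.eq_one_of_eventually (x := x) ?_) hg
    filter_upwards [φ.continuousAt hxs (h0.and hiff), φ.open_source.mem_nhds hxs] with y hy hys
    simpa [φ.left_inv hys] using hy.2.2 hy.1
  · refine ⟨_, inter_mem_nhdsWithin _ (inter_mem hU hiff), measure_mono_null ?_ hU0⟩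
    rintro _ ⟨⟨y, ⟨hys, hgy⟩, rfl⟩, hyU, hy⟩
    exact ⟨hyU, hy.1 (by rw [φ.left_inv hys]; exact hgy)⟩

/-- A point with finite orbit is fixed by a quotient of two terms of any sequence in the group. -/
theorem finiteOrbitSet_subset_iUnion_fixedBy {G : Subgroup (HolDiff n F)} (u : ℕ → G) :
    finiteOrbitSet G ⊆ ⋃ p : {p : ℕ × ℕ // p.1 ≠ p.2},
      MulAction.fixedBy F (((u p.1.1)⁻¹ * u p.1.2 : G) : HolDiff n F) := by
  intro x hx
  have hx : (MulAction.orbit G x).Finite := hx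
  obtain ⟨i, -, j, -, hij, h⟩ := Set.infinite_univ.exists_ne_map_eq_of_mapsTo
    (f := fun i ↦ u i • x) (fun i _ ↦ MulAction.mem_orbit x (u i)) hx
  refine Set.mem_iUnion.2 ⟨⟨(i, j), hij⟩, ?_⟩
  change ((u i)⁻¹ * u j) • x = x
  rw [mul_smul, ← h, inv_smul_smul]

end HolDiff

theorem theorem2 {n : ℕ} {F : Type*} [TopologicalSpace F] [T2Space F] [ConnectedSpace F]
    [ChartedSpace (Fin n → ℂ) F] [IsManifold 𝓘(ℂ, Fin n → ℂ) ω F]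
    (G : Subgroup (HolDiff n F)) :
    Finite G ∨ HasZeroMeasure n (HolDiff.finiteOrbitSet G) := by
  refine or_iff_not_imp_left.2 fun hG ↦ ?_
  have : Infinite G := not_finite_iff_infinite.1 hG
  have hu := (Infinite.natEmbedding G).injective
  refine ⟨IsManifold.maximalAtlas 𝓘(ℂ, Fin n → ℂ) ω F, subset_rfl, ?_, fun φ hφ ↦ ?_⟩
  · exact Set.eq_univ_of_forall fun x ↦ Set.mem_biUnion
      (IsManifold.chart_mem_maximalAtlas x) (mem_chart_source (Fin n → ℂ) x)
  · refine measure_mono_null (Set.image_mono (Set.inter_subset_inter_right _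
      (HolDiff.finiteOrbitSet_subset_iUnion_fixedBy (Infinite.natEmbedding G)))) ?_
    rw [Set.inter_iUnion, Set.image_iUnion, measure_iUnion_null_iff]
    rintro ⟨⟨i, j⟩, hij⟩
    refine HolDiff.measure_image_fixedBy_eq_zero (fun h ↦ hij ?_) hφ
    exact hu (inv_mul_eq_one.1 (Subtype.ext h))
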